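/- Let $\alpha$ be a finite ordinal. A quasi-polyadic algebra of dimension $\alpha$ is an algebra $\mathfrak A=\langle A,\cdot,-,\mathsf c_\Gamma,\mathsf s_\tau : \Gamma\subseteq\alpha,\ \tau\in{}^\alpha\alpha\rangle$ such that $\langle A,\cdot,-\rangle$ is a Boolean algebra and, for all $x,y\in A$, $\Gamma,\Delta\subseteq\alpha$ and $\sigma,\tau\in{}^\alpha\alpha$: $\mathsf c_\Gamma 0=0$; $x\le \mathsf c_\Gamma x$; $\mathsf c_\Gamma(x\cdot \mathsf c_\Gamma y)=\mathsf c_\Gamma x\cdot \mathsf c_\Gamma y$; $\mathsf c_\emptyset x=x$; $\mathsf c_\Gamma \mathsf c_\Delta x=\mathsf c_{\Gamma\cup\Delta}x$; $\mathsf s_{\mathrm{id}}x=x$; $\mathsf s_{\sigma\circ\tau}x=\mathsf s_\sigma \mathsf s_\tau x$; $\mathsf s_\sigma(x+y)=\mathsf s_\sigma x+\mathsf s_\sigma y$; $\mathsf s_\sigma(-x)=-\mathsf s_\sigma x$; $\mathsf s_\sigma \mathsf c_\Gamma x=\mathsf s_\tau \mathsf c_\Gamma x$ whenever $\sigma$ and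 $\tau$ agree on $\alpha\setminus\Gamma$; and $\mathsf c_\Gamma \mathsf s_\tau x=\mathsf s_\tau \mathsf c_\Delta x$ whenever $\Delta=\tau^{-1}[\Gamma]$ and $\tau$ is one-to-one on $\Delta$. For a set $U$ and $R\subseteq{}^\alpha U$ put $\mathsf C_\Gamma R=\{x\in{}^\alpha U : \text{some } y\in R \text{ agrees with } x \text{ on } \alpha\setminus\Gamma\}$ and $\mathsf S_\tau R=\{x\in{}^\alpha U : x\circ\tau\in R\}$. The algebra $\mathfrak A$ is called representable if it is isomorphic to a subalgebra of a product of full set algebras $\langle \mathcal P({}^\alpha U),\cap,-,\mathsf C_\Gamma,\mathsf S_\tau : \Gamma\subseteq\alpha,\ \tau\in{}^\alpha\alpha\rangle$. Its nonpermutational-substitutions free reduct is $\langle A,\cdot,-,\mathsf c_\Gamma,\mathsf s_\tau : \Gamma\subseteq\alpha,\ \tau \text{ a permutation of } \alpha\rangle$, and this reduct is called representable if it is isomorphic to a subalgebra of a product of algebras $\langle \mathcal P({}^\alpha U),\cap,-,\mathsf C_\Gamma,\mathsf S_\tau : \Gamma\subseteq\alpha,\ \tau \text{ a permutation of } \alpha\rangle$.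 Then a quasi-polyadic algebra of finite dimension $\alpha$ is representable if and only if its nonpermutational-substitutions free reduct is representable. -/

import Mathlib

universe u v w

/-- The operations, besides the Boolean ones, of an algebra of the similarity type of
quasi-polyadic algebras of finite dimension `n`: a cylindrification `c Γ` for every (finite) set
`Γ` of indices and a substitution `s τ` for every transformation `τ` of the index set.
(As `n` is finite, every subset and every transformation is finite.) -/
structure PolyadicOps (n : ℕ) (A : Type u) where
  c : Finset (Fin n) → A → A
  s : (Fin n → Fin n) → A → A

/-- The operations, besides the Boolean ones, of the similarity type in which only the
permutational substitutions are kept. -/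
structure PermPolyadicOps (n : ℕ) (A : Type u) where
  c : Finset (Fin n) → A → A
  s : Equiv.Perm (Fin n) → A → A

/-- The polyadic axioms: the Boolean algebra `A` with the operations `𝔄` is a quasi-polyadic
algebra of dimension `n`. -/
structure IsQPA {n : ℕ} {A : Type u} [BooleanAlgebra A] (𝔄 : PolyadicOps n A) : Prop where
  c_bot : ∀ Γ, 𝔄.c Γ ⊥ = ⊥
  le_c : ∀ Γ x, x ≤ 𝔄.c Γ x
  c_inf_c : ∀ Γ x y, 𝔄.c Γ (x ⊓ 𝔄.c Γ y) = 𝔄.c Γ x ⊓ 𝔄.c Γ y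
  c_empty : ∀ x, 𝔄.c ∅ x = x
  c_c : ∀ Γ Δ x, 𝔄.c Γ (𝔄.c Δ x) = 𝔄.c (Γ ∪ Δ) x
  s_id : ∀ x, 𝔄.s id x = x
  s_comp : ∀ σ τ x, 𝔄.s (σ ∘ τ) x = 𝔄.s σ (𝔄.s τ x)
  s_sup : ∀ σ x y, 𝔄.s σ (x ⊔ y) = 𝔄.s σ x ⊔ 𝔄.s σ y
  s_compl : ∀ σ x, 𝔄.s σ xᶜ = (𝔄.s σ x)ᶜ
  s_c_congr : ∀ (σ τ : Fin n → Fin n) (Γ : Finset (Fin n)) (x : A),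
    (∀ i, i ∉ Γ → σ i = τ i) → 𝔄.s σ (𝔄.c Γ x) = 𝔄.s τ (𝔄.c Γ x)
  c_s : ∀ (τ : Fin n → Fin n) (Γ Δ : Finset (Fin n)) (x : A),
    (∀ i, i ∈ Δ ↔ τ i ∈ Γ) → Set.InjOn τ ↑Δ → 𝔄.c Γ (𝔄.s τ x) = 𝔄.s τ (𝔄.c Δ x)

/-- Cylindrification of an `n`-ary relation over `U` along the indices in `Γ`. -/
def setCyl {n : ℕ} {U : Type w} (Γ : Finset (Fin n)) (R : Set (Fin n → U)) : Set (Fin n → U) :=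
  {x | ∃ y ∈ R, ∀ i, i ∉ Γ → y i = x i}

/-- Substitution of an `n`-ary relation over `U` along `τ`. -/
def setSubst {n : ℕ} {U : Type w} (τ : Fin n → Fin n) (R : Set (Fin n → U)) :
    Set (Fin n → U) :=
  {x | x ∘ τ ∈ R}

namespace PolyadicOps

/-- The full set algebra of all `n`-ary relations over `U`. -/
def full (n : ℕ) (U : Type w) : PolyadicOps n (Set (Fin n → U)) where
  c := setCyl
  s := setSubst

/-- The direct product (the operations are coordinatewise, as are the Boolean ones). -/
def prod {n : ℕ} {K : Type v} {B : K → Type w} (𝔅 : ∀ k, PolyadicOps n (B k)) :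
    PolyadicOps n (∀ k, B k) where
  c Γ x k := (𝔅 k).c Γ (x k)
  s τ x k := (𝔅 k).s τ (x k)

/-- `f` is an isomorphism of `𝔄` onto a subalgebra of `𝔅`. -/
structure IsEmbedding {n : ℕ} {A : Type u} {B : Type v} [BooleanAlgebra A] [BooleanAlgebra B]
    (𝔄 : PolyadicOps n A) (𝔅 : PolyadicOps n B) (f : A → B) : Prop where
  injective : Function.Injective f
  map_inf : ∀ x y, f (x ⊓ y) = f x ⊓ f y
  map_compl : ∀ x, f xᶜ = (f x)ᶜ
  map_c : ∀ Γ x, f (𝔄.c Γ x) = 𝔅.c Γ (f x)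
  map_s : ∀ τ x, f (𝔄.s τ x) = 𝔅.s τ (f x)

/-- Representability: isomorphism to a subalgebra of a product of full set algebras. -/
def Representable {n : ℕ} {A : Type u} [BooleanAlgebra A] (𝔄 : PolyadicOps n A) : Prop :=
  ∃ (K : Type v) (U : K → Type w) (f : A → ∀ k, Set (Fin n → U k)),
    IsEmbedding 𝔄 (prod fun k => full n (U k)) f

/-- The nonpermutational-substitutions free reduct. -/
def permReduct {n : ℕ} {A : Type u} (𝔄 : PolyadicOps n A) : PermPolyadicOps n A where
  c := 𝔄.c
  s τ := 𝔄.s τ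

end PolyadicOps

namespace PermPolyadicOps

/-- The full set algebra of all `n`-ary relations over `U`, in the reduced similarity type. -/
def full (n : ℕ) (U : Type w) : PermPolyadicOps n (Set (Fin n → U)) where
  c := setCyl
  s τ := setSubst τ

/-- The direct product (the operations are coordinatewise, as are the Boolean ones). -/
def prod {n : ℕ} {K : Type v} {B : K → Type w} (𝔅 : ∀ k, PermPolyadicOps n (B k)) :
    PermPolyadicOps n (∀ k, B k) where
  c Γ x k := (𝔅 k).c Γ (x k)
  s τ x k := (𝔅 k).s τ (x k)

/-- `f` is an isomorphism of `𝔄` onto a subalgebra of `𝔅`. -/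
structure IsEmbedding {n : ℕ} {A : Type u} {B : Type v} [BooleanAlgebra A] [BooleanAlgebra B]
    (𝔄 : PermPolyadicOps n A) (𝔅 : PermPolyadicOps n B) (f : A → B) : Prop where
  injective : Function.Injective f
  map_inf : ∀ x y, f (x ⊓ y) = f x ⊓ f y
  map_compl : ∀ x, f xᶜ = (f x)ᶜ
  map_c : ∀ Γ x, f (𝔄.c Γ x) = 𝔅.c Γ (f x)
  map_s : ∀ τ x, f (𝔄.s τ x) = 𝔅.s τ (f x)

/-- Representability: isomorphism to a subalgebra of a product of full set algebras of the reduced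
similarity type. -/
def Representable {n : ℕ} {A : Type u} [BooleanAlgebra A] (𝔄 : PermPolyadicOps n A) : Prop :=
  ∃ (K : Type v) (U : K → Type w) (f : A → ∀ k, Set (Fin n → U k)),
    IsEmbedding 𝔄 (prod fun k => full n (U k)) f

end PermPolyadicOps

/-! Given a representation of the reduct, non-injective substitutions may fail at sequences over
`U`. Since any true representation satisfies x ∘ τ ∈ F(a) iff x ∈ F(s_τ a), membership of a sequence
with repetitions is instead prescribed by the algebra: replace `U` by `U × ℕ` and test the
projection of x against s_τ a, where τ has the kernel of x and x ∘ τ = x (`blowUp`). The choice of τ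
is immaterial (`mem_s_c_iff_of_kernel_eq`): maps with equal kernels differ by a permutation, which
the given representation respects. The tags in ℕ allow distinct entries with the same projection,
which makes cylindrifications work (`blowUp_c`) and keeps the map injective (`mem_blowUp_pair_iff`).
-/

/-- Two maps on `Fin n` with the same kernel off `Γ` differ there by a permutation. -/
theorem exists_perm_comp_eqOn {n : ℕ} (σ τ : Fin n → Fin n) (Γ : Finset (Fin n))
    (h : ∀ i, i ∉ Γ → ∀ j, j ∉ Γ → (σ i = σ j ↔ τ i = τ j)) :
    ∃ ρ : Equiv.Perm (Fin n), ∀ i, i ∉ Γ → σ i = ρ (τ i) := by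
  classical
  let g : Fin n → Fin n := fun j => if hj : ∃ i, i ∉ Γ ∧ τ i = j then σ hj.choose else j
  have hg : ∀ i, i ∉ Γ → g (τ i) = σ i := by
    intro i hi
    have hj : ∃ i', i' ∉ Γ ∧ τ i' = τ i := ⟨i, hi, rfl⟩
    simp only [g, dif_pos hj]
    exact (h _ hj.choose_spec.1 _ hi).2 hj.choose_spec.2
  obtain ⟨ρ, hρ⟩ := Finset.exists_equiv_extend_of_card_eq (t := (Finset.univ : Finset (Fin n)))
    (s := Γᶜ.image τ) (f := g) (by simp) (Finset.subset_univ _) (by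
      intro a ha b hb hab
      simp only [Finset.coe_image, Set.mem_image, Finset.mem_coe, Finset.mem_compl] at ha hb
      obtain ⟨i, hi, rfl⟩ := ha
      obtain ⟨j, hj, rfl⟩ := hb
      rw [hg i hi, hg j hj] at hab
      exact (h i hi j hj).1 hab)
  refine ⟨ρ.trans (Equiv.subtypeUnivEquiv fun i => Finset.mem_univ i), fun i hi => ?_⟩
  have := hρ (τ i) (Finset.mem_image_of_mem τ (Finset.mem_compl.2 hi))
  simpa [hg i hi] using this.symm

/-- A map on `Fin n` can be altered on `Γ` so that it becomes injective on `Γ`, with the values on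
`Γ` distinct from those off `Γ`. -/
theorem exists_eqOn_compl_injOn {n : ℕ} (τ : Fin n → Fin n) (Γ : Finset (Fin n)) :
    ∃ σ : Fin n → Fin n, (∀ i, i ∉ Γ → σ i = τ i) ∧ Set.InjOn σ Γ ∧
      ∀ i, i ∈ Γ → ∀ j, j ∉ Γ → σ i ≠ σ j := by
  classical
  have hcard : Fintype.card Γ ≤ Fintype.card ((Γᶜ.image τ)ᶜ : Finset (Fin n)) := by
    rw [Fintype.card_coe, Fintype.card_coe, Finset.card_compl]
    have h1 : (Γᶜ.image τ).card ≤ Γᶜ.card := Finset.card_image_le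
    rw [Finset.card_compl] at h1
    have h2 := Finset.card_le_univ Γ
    omega
  obtain ⟨e⟩ := Function.Embedding.nonempty_of_card_le hcard
  have hin : ∀ i (hi : i ∈ Γ),
      (fun i => if hi : i ∈ Γ then (e ⟨i, hi⟩ : Fin n) else τ i) i = e ⟨i, hi⟩ :=
    fun i hi => dif_pos hi
  have hout : ∀ i, i ∉ Γ →
      (fun i => if hi : i ∈ Γ then (e ⟨i, hi⟩ : Fin n) else τ i) i = τ i :=
    fun i hi => dif_neg hi
  refine ⟨fun i => if hi : i ∈ Γ then (e ⟨i, hi⟩ : Fin n) else τ i, hout, ?_, ?_⟩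
  · intro i hi j hj hij
    rw [hin i hi, hin j hj] at hij
    simpa using e.injective (Subtype.ext hij)
  · intro i hi j hj hij
    rw [hin i hi, hout j hj] at hij
    have := (e ⟨i, hi⟩).2
    rw [Finset.mem_compl] at this
    exact this (hij ▸ Finset.mem_image_of_mem τ (Finset.mem_compl.2 hj))

namespace IsQPA

variable {n : ℕ} {A : Type u} [BooleanAlgebra A] {𝔄 : PolyadicOps n A}

theorem s_inf (h : IsQPA 𝔄) (σ : Fin n → Fin n) (x y : A) :
    𝔄.s σ (x ⊓ y) = 𝔄.s σ x ⊓ 𝔄.s σ y := by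
  rw [← compl_inj_iff, ← h.s_compl, compl_inf, compl_inf, h.s_sup, h.s_compl, h.s_compl]

/-- `s τ (c Γ x)` does not depend on the coordinates outside the image under `τ` of the complement
of `Γ`. -/
theorem c_s_c (h : IsQPA 𝔄) (τ : Fin n → Fin n) (Γ Θ : Finset (Fin n)) (x : A)
    (hΘ : ∀ j, j ∈ Θ ↔ ∀ i, i ∉ Γ → τ i ≠ j) :
    𝔄.c Θ (𝔄.s τ (𝔄.c Γ x)) = 𝔄.s τ (𝔄.c Γ x) := by
  classical
  by_cases hΓ : ∃ i₀, i₀ ∉ Γ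
  · obtain ⟨i₀, hi₀⟩ := hΓ
    -- Sending all of `Γ` to `τ i₀`, a value already taken off `Γ`, does not change the substitution
    -- on `c Γ x` and makes the preimage of `Θ` empty.
    have hσ : ∀ i, i ∉ Γ → τ i = if i ∈ Γ then τ i₀ else τ i := fun i hi => (if_neg hi).symm
    rw [h.s_c_congr _ _ Γ x hσ, h.c_s _ Θ ∅, h.c_empty]
    · intro i
      simp only [Finset.notMem_empty, false_iff, hΘ]
      intro hi
      by_cases hiΓ : i ∈ Γ
      · exact hi i₀ hi₀ (if_pos hiΓ).symm
      · exact hi i hiΓ (if_neg hiΓ).symm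
    · simp
  · push Not at hΓ
    have hΓΘ : Γ = Θ := by
      ext j
      simp [hΘ, hΓ]
    rw [h.s_c_congr τ id Γ x fun i hi => absurd (hΓ i) hi, h.s_id, h.c_c, ← hΓΘ,
      Finset.union_self]

end IsQPA

/-- A transformation of the index set which has the same kernel as `x` and fixes `x`. -/
noncomputable def kernelRetract {n : ℕ} {V : Type w} (x : Fin n → V) (i : Fin n) : Fin n :=
  Set.rangeSplitting x ⟨x i, Set.mem_range_self i⟩

theorem apply_kernelRetract {n : ℕ} {V : Type w} (x : Fin n → V) (i : Fin n) :
    x (kernelRetract x i) = x i :=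
  Set.apply_rangeSplitting x _

theorem kernelRetract_eq_iff {n : ℕ} {V : Type w} (x : Fin n → V) (i j : Fin n) :
    kernelRetract x i = kernelRetract x j ↔ x i = x j := by
  simp [kernelRetract, (Set.rangeSplitting_injective x).eq_iff]

/-- The relation over `U × ℕ` that a map `g` into the relations over `U` assigns to `a`: a sequence
with kernel retract `τ` belongs to it when its projection belongs to `g (s τ a)`. -/
def blowUp {n : ℕ} {A : Type u} {U : Type w} (𝔄 : PolyadicOps n A)
    (g : A → Set (Fin n → U)) (a : A) : Set (Fin n → U × ℕ) :=
  {x | (fun i => (x i).1) ∈ g (𝔄.s (kernelRetract x) a)}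

section BlowUp

variable {n : ℕ} {A : Type u} [BooleanAlgebra A] {𝔄 : PolyadicOps n A} {U : Type w}
  {g : A → Set (Fin n → U)}

/-- Off `Γ`, σ is ρ ∘ τ for a permutation ρ, and moving ρ to the sequence turns y into y ∘ ρ. This
agrees with z on τ[Γᶜ], the only coordinates on which `s τ (c Γ a)` depends. -/
theorem mem_s_c_iff_of_kernel_eq (h : IsQPA 𝔄) (hc : ∀ Γ a, g (𝔄.c Γ a) = setCyl Γ (g a))
    (hs : ∀ (ρ : Equiv.Perm (Fin n)) a, g (𝔄.s ρ a) = setSubst ρ (g a))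
    (σ τ : Fin n → Fin n) (Γ : Finset (Fin n)) (y z : Fin n → U) (a : A)
    (hker : ∀ i, i ∉ Γ → ∀ j, j ∉ Γ → (σ i = σ j ↔ τ i = τ j))
    (hyz : ∀ i, i ∉ Γ → y (σ i) = z (τ i)) :
    y ∈ g (𝔄.s σ (𝔄.c Γ a)) ↔ z ∈ g (𝔄.s τ (𝔄.c Γ a)) := by
  classical
  obtain ⟨ρ, hρ⟩ := exists_perm_comp_eqOn σ τ Γ hker
  have hΘ : ∀ j, j ∈ (Γᶜ.image τ)ᶜ ↔ ∀ i, i ∉ Γ → τ i ≠ j := by simp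
  rw [h.s_c_congr σ (ρ ∘ τ) Γ a hρ, h.s_comp, hs, ← h.c_s_c τ Γ _ a hΘ, hc]
  have hagree : ∀ i, i ∉ (Γᶜ.image τ)ᶜ → y (ρ i) = z i := by
    intro j hj
    simp only [Finset.mem_compl, not_not, Finset.mem_image] at hj
    obtain ⟨i, hi, rfl⟩ := hj
    rw [← hρ i hi, hyz i hi]
  constructor
  · rintro ⟨v, hv, hvy⟩
    exact ⟨v, hv, fun i hi => (hvy i hi).trans (hagree i hi)⟩
  · rintro ⟨v, hv, hvz⟩
    exact ⟨v, hv, fun i hi => (hvz i hi).trans (hagree i hi).symm⟩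

/-- Frees the definition from the chosen retract: σ need not fix x, and z is constrained only on the
range of σ. -/
theorem mem_blowUp_iff (h : IsQPA 𝔄) (hc : ∀ Γ a, g (𝔄.c Γ a) = setCyl Γ (g a))
    (hs : ∀ (ρ : Equiv.Perm (Fin n)) a, g (𝔄.s ρ a) = setSubst ρ (g a))
    (σ : Fin n → Fin n) (x : Fin n → U × ℕ) (z : Fin n → U) (a : A)
    (hker : ∀ i j, σ i = σ j ↔ x i = x j) (hz : ∀ i, z (σ i) = (x i).1) :
    x ∈ blowUp 𝔄 g a ↔ z ∈ g (𝔄.s σ a) := by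
  have := mem_s_c_iff_of_kernel_eq h hc hs (kernelRetract x) σ ∅ (fun i => (x i).1) z a
    (fun i _ j _ => (kernelRetract_eq_iff x i j).trans (hker i j).symm)
    (fun i _ => by rw [hz i]; exact congrArg Prod.fst (apply_kernelRetract x i))
  rwa [h.c_empty] at this

theorem blowUp_s (h : IsQPA 𝔄) (hc : ∀ Γ a, g (𝔄.c Γ a) = setCyl Γ (g a))
    (hs : ∀ (ρ : Equiv.Perm (Fin n)) a, g (𝔄.s ρ a) = setSubst ρ (g a))
    (σ : Fin n → Fin n) (a : A) :
    blowUp 𝔄 g (𝔄.s σ a) = setSubst σ (blowUp 𝔄 g a) := by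
  ext x
  have h2 : x ∘ σ ∈ blowUp 𝔄 g a ↔ _ :=
    mem_blowUp_iff h hc hs (kernelRetract x ∘ σ) (x ∘ σ) (fun i => (x i).1) a
      (fun i j => kernelRetract_eq_iff x _ _)
      (fun i => congrArg Prod.fst (apply_kernelRetract x (σ i)))
  rw [h.s_comp] at h2
  exact h2.symm

theorem blowUp_c (h : IsQPA 𝔄) (hc : ∀ Γ a, g (𝔄.c Γ a) = setCyl Γ (g a))
    (hs : ∀ (ρ : Equiv.Perm (Fin n)) a, g (𝔄.s ρ a) = setSubst ρ (g a))
    (hmono : Monotone g) (Γ : Finset (Fin n)) (a : A) :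
    blowUp 𝔄 g (𝔄.c Γ a) = setCyl Γ (blowUp 𝔄 g a) := by
  classical
  ext x
  constructor
  · intro hx
    -- The axiom `c_s` needs a map injective on `Γ`; under `c Γ` the retract may be altered there.
    obtain ⟨σ, hσ, hinj, hdisj⟩ := exists_eqOn_compl_injOn (kernelRetract x) Γ
    have hx' : (fun i => (x i).1) ∈ g (𝔄.c (Γ.image σ) (𝔄.s σ a)) := by
      rw [h.c_s σ (Γ.image σ) Γ a ?_ hinj, h.s_c_congr σ (kernelRetract x) Γ a hσ]
      · exact hx
      · intro i
        refine ⟨Finset.mem_image_of_mem σ, fun hi => ?_⟩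
        obtain ⟨j, hj, hji⟩ := Finset.mem_image.1 hi
        by_contra hiΓ
        exact hdisj j hj i hiΓ hji
    rw [hc] at hx'
    obtain ⟨z, hz, hzx⟩ := hx'
    obtain ⟨m, hm⟩ : ∃ m, ∀ i, (x i).2 < m := by
      refine ⟨(Finset.univ.sup fun i => (x i).2) + 1, fun i => Nat.lt_succ_of_le ?_⟩
      exact Finset.le_sup (f := fun i => (x i).2) (Finset.mem_univ i)
    -- The fresh tags `m + i` make the entries on `Γ` distinct from each other and from all entries
    -- of `x`, so `y` has exactly the kernel of `σ`.
    let y : Fin n → U × ℕ := fun i => if i ∈ Γ then (z (σ i), m + i) else x i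
    have hin : ∀ i, i ∈ Γ → y i = (z (σ i), m + i) := fun i hi => if_pos hi
    have hout : ∀ i, i ∉ Γ → y i = x i := fun i hi => if_neg hi
    have hne : ∀ i, i ∈ Γ → ∀ j, j ∉ Γ → y i ≠ y j := by
      intro i hi j hj hij
      rw [hin i hi, hout j hj] at hij
      have h2 := congrArg Prod.snd hij
      have := hm j
      simp only at h2
      omega
    refine ⟨y, (mem_blowUp_iff h hc hs σ y z a ?_ ?_).2 hz, hout⟩
    · intro i j
      by_cases hi : i ∈ Γ <;> by_cases hj : j ∈ Γ
      · have : σ i = σ j ↔ i = j := hinj.eq_iff hi hj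
        rw [this]
        refine ⟨fun e => e ▸ rfl, fun e => ?_⟩
        rw [hin i hi, hin j hj] at e
        have h2 := congrArg Prod.snd e
        simp only at h2
        exact Fin.ext (by omega)
      · exact iff_of_false (hdisj i hi j hj) (hne i hi j hj)
      · exact iff_of_false (hdisj j hj i hi).symm (hne j hj i hi).symm
      · rw [hσ i hi, hσ j hj, hout i hi, hout j hj, kernelRetract_eq_iff]
    · intro i
      by_cases hi : i ∈ Γ
      · rw [hin i hi]
      · rw [hout i hi, hzx, hσ i hi]
        · exact congrArg Prod.fst (apply_kernelRetract x i)
        intro hmem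
        obtain ⟨j, hj, hji⟩ := Finset.mem_image.1 hmem
        exact hdisj j hj i hi hji
  · rintro ⟨y, hy, hyx⟩
    have hsmono : Monotone (𝔄.s (kernelRetract y)) := fun b b' hbb' => by
      rw [← inf_eq_left, ← h.s_inf, inf_eq_left.2 hbb']
    have hy' := hmono (hsmono (h.le_c Γ a)) hy
    refine (mem_s_c_iff_of_kernel_eq h hc hs (kernelRetract y) (kernelRetract x) Γ
      (fun i => (y i).1) (fun i => (x i).1) a ?_ ?_).1 hy'
    · intro i hi j hj
      rw [kernelRetract_eq_iff, kernelRetract_eq_iff, hyx i hi, hyx j hj]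
    · intro i hi
      simp only [apply_kernelRetract, hyx i hi]

/-- Distinct tags make the kernel trivial, so σ = id applies. Hence `blowUp` loses no information
about `g`. -/
theorem mem_blowUp_pair_iff (h : IsQPA 𝔄) (hc : ∀ Γ a, g (𝔄.c Γ a) = setCyl Γ (g a))
    (hs : ∀ (ρ : Equiv.Perm (Fin n)) a, g (𝔄.s ρ a) = setSubst ρ (g a))
    (z : Fin n → U) (a : A) :
    (fun i => (z i, (i : ℕ))) ∈ blowUp 𝔄 g a ↔ z ∈ g a := by
  rw [mem_blowUp_iff h hc hs id _ z a ?_ fun _ => rfl, h.s_id]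
  intro i j
  refine ⟨fun e => by rw [id, id] at e; rw [e], fun e => Fin.ext (congrArg Prod.snd e)⟩

end BlowUp

theorem corollary1 {n : ℕ} {A : Type u} [BooleanAlgebra A] (𝔄 : PolyadicOps n A)
    (h𝔄 : IsQPA 𝔄) :
    PolyadicOps.Representable.{u, v, w} 𝔄 ↔
      PermPolyadicOps.Representable.{u, v, w} 𝔄.permReduct := by
  constructor
  · rintro ⟨K, U, f, hf⟩
    exact ⟨K, U, f, hf.injective, hf.map_inf, hf.map_compl, hf.map_c, fun τ => hf.map_s τ⟩
  · rintro ⟨K, U, f, hf⟩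
    have hc : ∀ k Γ a, f (𝔄.c Γ a) k = setCyl Γ (f a k) := fun k Γ a =>
      congrFun (hf.map_c Γ a) k
    have hs : ∀ k (ρ : Equiv.Perm (Fin n)) a, f (𝔄.s ρ a) k = setSubst ρ (f a k) := fun k ρ a =>
      congrFun (hf.map_s ρ a) k
    have hmono : ∀ k, Monotone fun a => f a k := fun k a b hab => by
      have h1 := congrFun (hf.map_inf a b) k
      rw [inf_eq_left.2 hab] at h1
      exact inf_eq_left.1 h1.symm
    refine ⟨K, fun k => U k × ℕ, fun a k => blowUp 𝔄 (fun b => f b k) a, ?_, ?_, ?_, ?_, ?_⟩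
    · intro a b hab
      refine hf.injective (funext fun k => Set.ext fun z => ?_)
      rw [← mem_blowUp_pair_iff (g := fun b => f b k) h𝔄 (hc k) (hs k) z a,
        ← mem_blowUp_pair_iff (g := fun b => f b k) h𝔄 (hc k) (hs k) z b]
      exact iff_of_eq (congrArg (_ ∈ ·) (congrFun hab k))
    · intro a b
      funext k
      ext x
      simp only [blowUp, h𝔄.s_inf, hf.map_inf]
      rfl
    · intro a
      funext k
      ext x
      simp only [blowUp, h𝔄.s_compl, hf.map_compl]
      rfl
    · intro Γ a
      exact funext fun k => blowUp_c h𝔄 (hc k) (hs k) (hmono k) Γ a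
    · intro τ a
      exact funext fun k => blowUp_s h𝔄 (hc k) (hs k) τ a
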